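/- Let $X$ be a complex Banach space, $I$ its identity operator, and $A_1$ a bounded linear operator on $X$. Let $\sigma$ be the set of all $z\in\mathbb C$ for which $I-zA_1$ is not invertible, and suppose that for some $\eta>0$ the point $z=1$ is the only element of $\sigma$ in the open disk $\{|z|<1+\eta\}$ (unit root assumption). Put $$P=-\frac1{2\pi i}\oint_{|z-1|=r}(I-zA_1)^{-1}A_1\,dz,\qquad G=(I-A_1)P,$$ where the circle is oriented counterclockwise and $r>0$ is any radius such that $1$ is the only point of $\sigma$ in the closed disk $\{|z-1|\le r\}$. Then for every integer $\ell\ge 0$ the following are equivalent. (a) $z\mapsto (I-zA_1)^{-1}$ has a pole at $z=1$, of order at most $\ell+1$. (b) $n^{-1}\,\|G^{\ell}(I-G)^n\|\to 0$ as $n\to\infty$ (operator norm), and for some integer $m\ge \ell+1$ the range of $G^m$ is closed. (c) $G^{\ell+1}=0$. -/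

import Mathlib

open Filter Topology

noncomputable section

namespace LinearPencil

variable {E : Type*} [NormedAddCommGroup E] [NormedSpace ℂ E]

/-- The simple linear operator pencil `z ↦ I - z A`. -/
def pencil (A : E →L[ℂ] E) (z : ℂ) : E →L[ℂ] E := 1 - z • A

/-- The spectrum of the pencil: the points `z` at which `I - z A` is not invertible
in the algebra of bounded operators. -/
def pencilSpectrum (A : E →L[ℂ] E) : Set ℂ := {z | ¬ IsUnit (pencil A z)}

/-- The inverse `z ↦ (I - z A)⁻¹` (with the value `0` on the spectrum of the pencil). -/
def pencilInv (A : E →L[ℂ] E) (z : ℂ) : E →L[ℂ] E := Ring.inverse (pencil A z)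

/-- Unit root assumption: for some `η > 0`, the point `1` is the only element of the spectrum of the
pencil in the open disk of radius `1 + η` about the origin. -/
def UnitRoot (A : E →L[ℂ] E) : Prop :=
  ∃ η : ℝ, 0 < η ∧ pencilSpectrum A ∩ Metric.ball (0 : ℂ) (1 + η) = {1}

/-- The coefficient `N_j` in the Laurent expansion `(I - z A)⁻¹ = - ∑ N_j (z - 1) ^ j` around `1`,
`N_j = - (2 π i)⁻¹ ∮ (I - z A)⁻¹ / (z - 1) ^ (j + 1) dz`, the integral being over the
counterclockwise circle of radius `r` about `1`. -/
def laurentCoeff (A : E →L[ℂ] E) (r : ℝ) (j : ℤ) : E →L[ℂ] E :=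
  -((2 * (Real.pi : ℂ) * Complex.I)⁻¹ •
    ∮ z in C((1 : ℂ), r), ((z - 1) ^ (j + 1))⁻¹ • pencilInv A z)

/-- The operator `P = N_{-1} A = - (2 π i)⁻¹ ∮ (I - z A)⁻¹ A dz`. -/
def spectralProj (A : E →L[ℂ] E) (r : ℝ) : E →L[ℂ] E := laurentCoeff A r (-1) * A

/-- The operator `G = (I - A) P`. -/
def nilPart (A : E →L[ℂ] E) (r : ℝ) : E →L[ℂ] E := (1 - A) * spectralProj A r

/-- `f` has a pole of order (exactly) `k ≥ 1` at `z₀`. -/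
def HasPoleOfOrder {F : Type*} [NormedAddCommGroup F] [NormedSpace ℂ F]
    (f : ℂ → F) (z₀ : ℂ) (k : ℕ) : Prop :=
  MeromorphicAt f z₀ ∧ 1 ≤ k ∧ meromorphicOrderAt f z₀ = ((-(k : ℤ) : ℤ) : WithTop ℤ)

end LinearPencil

end

/-! Both (a) and (b) are compared with (c). Let `M_k` be the moment of `(z - 1) ^ k` against the
resolvent. Then `A M_{k+1} = (1 - A) M_k` and `A M_0 M_k = M_k`, so `G ^ (k + 1) = A ^ (k + 2)
M_{k+1}` (`nilPart_pow_succ`). A pole of order at most `ℓ + 1` forces `M_{ℓ+1} = 0`, giving (c).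
Conversely, off the range of `P` the resolvent is analytic at 1, and on it multiplication by `z - 1`
acts as `M_0 G` up to an analytic term, so `G ^ (ℓ + 1) = 0` bounds the pole order.

For (b) implies (c), the growth condition makes the Cesàro means of `1 - G` tend to 0 on the range
of `G ^ m`. If that range is closed, `G` is bounded below on it. But shrinking the circle shows that
`G` is quasinilpotent, so `G ^ m = 0`, and the exponent then descends to `ℓ + 1`. -/

namespace LinearPencil

variable {E : Type*} [NormedAddCommGroup E] [NormedSpace ℂ E]

/-! ### Cesàro means and the equivalence of (b) and (c) -/

/-- The Cesàro mean of the first `n` powers of `T`. -/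
noncomputable def cesaroMean (T : E →L[ℂ] E) (n : ℕ) : E →L[ℂ] E :=
  (n : ℂ)⁻¹ • ∑ k ∈ Finset.range n, T ^ k

lemma pow_succ_mul_cesaroMean (G : E →L[ℂ] E) (ℓ n : ℕ) :
    G ^ (ℓ + 1) * cesaroMean (1 - G) n = (n : ℂ)⁻¹ • (G ^ ℓ - G ^ ℓ * (1 - G) ^ n) := by
  have h := mul_neg_geom_sum (1 - G) n
  rw [sub_sub_cancel] at h
  rw [cesaroMean, mul_smul_comm, pow_succ, mul_assoc, h, mul_sub, mul_one]

/-- Each `1 - (1 - G) ^ k` is divisible by `G`, hence so is their average. -/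
lemma exists_one_sub_cesaroMean (G : E →L[ℂ] E) {n : ℕ} (hn : n ≠ 0) :
    ∃ S : E →L[ℂ] E, 1 - cesaroMean (1 - G) n = S * G := by
  refine ⟨(n : ℂ)⁻¹ • ∑ k ∈ Finset.range n, ∑ i ∈ Finset.range k, (1 - G) ^ i, ?_⟩
  have h (k : ℕ) : (∑ i ∈ Finset.range k, (1 - G) ^ i) * G = 1 - (1 - G) ^ k := by
    have h := geom_sum_mul_neg (1 - G) k
    rwa [sub_sub_cancel] at h
  have hn' : (n : ℂ) ≠ 0 := by exact_mod_cast hn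
  rw [smul_mul_assoc, Finset.sum_mul, Finset.sum_congr rfl fun k _ => h k,
    Finset.sum_sub_distrib, smul_sub, cesaroMean]
  congr 1
  rw [Finset.sum_const, Finset.card_range, ← Nat.cast_smul_eq_nsmul ℂ, smul_smul,
    inv_mul_cancel₀ hn', one_smul]

lemma tendsto_pow_mul_cesaroMean {G : E →L[ℂ] E} {ℓ : ℕ}
    (h : Tendsto (fun n : ℕ => (n : ℝ)⁻¹ * ‖G ^ ℓ * (1 - G) ^ n‖) atTop (𝓝 0))
    {m : ℕ} (hm : ℓ + 1 ≤ m) :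
    Tendsto (fun n => G ^ m * cesaroMean (1 - G) n) atTop (𝓝 0) := by
  have h0 : Tendsto (fun n => G ^ (ℓ + 1) * cesaroMean (1 - G) n) atTop (𝓝 0) := by
    have h1 : Tendsto (fun n : ℕ => (n : ℝ)⁻¹ * ‖G ^ ℓ‖ + (n : ℝ)⁻¹ * ‖G ^ ℓ * (1 - G) ^ n‖)
        atTop (𝓝 0) := by
      have h2 := (tendsto_inv_atTop_nhds_zero_nat (𝕜 := ℝ)).mul_const ‖G ^ ℓ‖
      simpa using h2.add h
    refine squeeze_zero_norm (fun n => ?_) h1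
    rw [pow_succ_mul_cesaroMean, norm_smul, norm_inv, Complex.norm_natCast, ← mul_add]
    gcongr
    exact norm_sub_le _ _
  obtain ⟨j, rfl⟩ := Nat.exists_eq_add_of_le' hm
  have h3 := h0.const_mul (G ^ j)
  simpa only [← mul_assoc, ← pow_add, mul_zero] using h3

lemma commute_cesaroMean (G : E →L[ℂ] E) (n : ℕ) : Commute G (cesaroMean (1 - G) n) := by
  refine Commute.smul_right (Commute.sum_right _ _ _ fun i _ => ?_) _
  exact ((Commute.one_right G).sub_right (Commute.refl G)).pow_right i

/-- If the Cesàro means of `1 - G` vanish asymptotically on the closed range of a power of a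
quasinilpotent operator `G`, then this power is zero. -/
lemma pow_eq_zero_of_isClosed_range [CompleteSpace E] {G : E →L[ℂ] E}
    (hG : ∀ c : ℝ, 0 < c → Tendsto (fun n : ℕ => c ^ n * ‖G ^ n‖) atTop (𝓝 0)) {m : ℕ}
    (h : Tendsto (fun n => G ^ m * cesaroMean (1 - G) n) atTop (𝓝 0))
    (hcl : IsClosed (Set.range (G ^ m))) : G ^ m = 0 := by
  have hcl' : IsClosed ((G ^ m).range : Set E) := hcl
  have : CompleteSpace (G ^ m).range := hcl'.completeSpace_coe
  obtain ⟨C, hC, hpre⟩ :=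
    ContinuousLinearMap.exists_preimage_norm_le (G ^ m).rangeRestrict
      (G ^ m).toLinearMap.surjective_rangeRestrict
  have hpre' : ∀ x, ∃ x', (G ^ m) x' = (G ^ m) x ∧ ‖x'‖ ≤ C * ‖(G ^ m) x‖ := fun x => by
    obtain ⟨x', h1, h2⟩ := hpre ⟨(G ^ m) x, x, rfl⟩
    exact ⟨x', congrArg Subtype.val h1, h2⟩
  -- `C` bounds preimages under `G ^ m` (open mapping), so the threshold `(2 * C)⁻¹` makes the mean
  -- at most halve norms on the range.
  obtain ⟨n, hn, hn0⟩ := ((h.norm.eventually_lt_const (u := (2 * C)⁻¹)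
    (by rw [norm_zero]; positivity)).and (eventually_ne_atTop 0)).exists
  obtain ⟨S, hS⟩ := exists_one_sub_cesaroMean G hn0
  have hbelow : ∀ x, ‖(G ^ m) x‖ ≤ (2 * ‖S‖ + 1) * ‖G ((G ^ m) x)‖ := fun x => by
    obtain ⟨x', h1, h2⟩ := hpre' x
    set y := (G ^ m) x with hy
    have h3 : ‖cesaroMean (1 - G) n y‖ ≤ ‖y‖ / 2 := by
      have h4 : cesaroMean (1 - G) n y = (G ^ m * cesaroMean (1 - G) n : E →L[ℂ] E) x' := by
        rw [((commute_cesaroMean G n).pow_left m).eq, ← h1]; rfl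
      rw [h4]
      calc _ ≤ ‖G ^ m * cesaroMean (1 - G) n‖ * ‖x'‖ := ContinuousLinearMap.le_opNorm _ _
        _ ≤ (2 * C)⁻¹ * (C * ‖y‖) := by gcongr
        _ = ‖y‖ / 2 := by field_simp
    have h5 : y = cesaroMean (1 - G) n y + S (G y) := by
      have h6 := congrArg (fun U : E →L[ℂ] E => U y) hS
      change y - cesaroMean (1 - G) n y = S (G y) at h6
      rw [← h6]; abel
    have h7 : ‖y‖ ≤ ‖cesaroMean (1 - G) n y‖ + ‖S (G y)‖ := by
      conv_lhs => rw [h5]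
      exact norm_add_le _ _
    have h8 := S.le_opNorm (G y)
    nlinarith [norm_nonneg (G y)]
  set K := 2 * ‖S‖ + 1
  have hK : 0 < K := by positivity
  -- The range is `G`-invariant, so the lower bound iterates; quasinilpotency with `c = K` then
  -- kills the right side.
  have hiter : ∀ (j : ℕ) (x : E), ‖(G ^ m) x‖ ≤ K ^ j * ‖(G ^ j) ((G ^ m) x)‖ := by
    intro j
    induction j with
    | zero => intro x; simp
    | succ j ih =>
      intro x
      have e : (G ^ m) (G x) = G ((G ^ m) x) :=
        congrArg (fun U : E →L[ℂ] E => U x) ((Commute.refl G).pow_left m).eq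
      have h1 := ih (G x)
      rw [e] at h1
      calc _ ≤ K * ‖G ((G ^ m) x)‖ := hbelow x
        _ ≤ K * (K ^ j * ‖(G ^ j) (G ((G ^ m) x))‖) := by gcongr
        _ = K ^ (j + 1) * ‖(G ^ (j + 1)) ((G ^ m) x)‖ := by
          rw [pow_succ G j, pow_succ' K j, mul_assoc]; rfl
  ext x
  have hlim := (hG K hK).mul_const ‖(G ^ m) x‖
  rw [zero_mul] at hlim
  have h0 : ‖(G ^ m) x‖ ≤ 0 := ge_of_tendsto' hlim fun j => (hiter j x).trans (by
    rw [mul_assoc]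
    gcongr
    exact ContinuousLinearMap.le_opNorm _ _)
  simpa using h0

lemma pow_mul_cesaroMean_of_pow_succ_eq_zero {G : E →L[ℂ] E} {p n : ℕ} (hn : n ≠ 0)
    (hp : G ^ (p + 1) = 0) : G ^ p * cesaroMean (1 - G) n = G ^ p := by
  obtain ⟨S, hS⟩ := exists_one_sub_cesaroMean G hn
  have h := (commute_cesaroMean G n).pow_left p
  have h1 : cesaroMean (1 - G) n = 1 - S * G := by rw [← hS, sub_sub_cancel]
  rw [h.eq, h1, sub_mul, one_mul, mul_assoc, ← pow_succ', hp, mul_zero, sub_zero]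

lemma pow_succ_eq_zero_of_tendsto [CompleteSpace E] {G : E →L[ℂ] E}
    (hG : ∀ c : ℝ, 0 < c → Tendsto (fun n : ℕ => c ^ n * ‖G ^ n‖) atTop (𝓝 0)) {ℓ : ℕ}
    (h : Tendsto (fun n : ℕ => (n : ℝ)⁻¹ * ‖G ^ ℓ * (1 - G) ^ n‖) atTop (𝓝 0))
    {m : ℕ} (hm : ℓ + 1 ≤ m) (hcl : IsClosed (Set.range (G ^ m))) : G ^ (ℓ + 1) = 0 := by
  have h0 := pow_eq_zero_of_isClosed_range hG (tendsto_pow_mul_cesaroMean h hm) hcl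
  induction m, hm using Nat.le_induction with
  | base => exact h0
  | succ p hp ih =>
    -- As `G ^ (p + 1) = 0`, the mean fixes `G ^ p`: a constant sequence that tends to 0.
    have h1 : G ^ p = 0 := by
      refine tendsto_nhds_unique (tendsto_const_nhds.congr' ?_) (tendsto_pow_mul_cesaroMean h hp)
      filter_upwards [eventually_ne_atTop 0] with n hn
      exact (pow_mul_cesaroMean_of_pow_succ_eq_zero hn h0).symm
    refine ih ?_ h1
    rw [h1]
    simp

lemma tendsto_and_isClosed_of_pow_succ_eq_zero {G : E →L[ℂ] E} {ℓ : ℕ} (h : G ^ (ℓ + 1) = 0) :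
    Tendsto (fun n : ℕ => (n : ℝ)⁻¹ * ‖G ^ ℓ * (1 - G) ^ n‖) atTop (𝓝 0) ∧
      ∃ m : ℕ, ℓ + 1 ≤ m ∧ IsClosed (Set.range (G ^ m)) := by
  refine ⟨?_, ℓ + 1, le_rfl, ?_⟩
  · have h1 (n : ℕ) : G ^ ℓ * (1 - G) ^ n = G ^ ℓ := by
      induction n with
      | zero => simp
      | succ n ih => rw [pow_succ, ← mul_assoc, ih, mul_sub, mul_one, ← pow_succ, h, sub_zero]
    simp only [h1]
    simpa using (tendsto_inv_atTop_nhds_zero_nat (𝕜 := ℝ)).mul_const ‖G ^ ℓ‖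
  · rw [h]
    simp

end LinearPencil

/-! ### Resolvent of the pencil and its moments -/

namespace LinearPencil

variable {E : Type*} [NormedAddCommGroup E] [NormedSpace ℂ E]

lemma pencilInv_mul_pencil {A : E →L[ℂ] E} {z : ℂ} (hz : IsUnit (pencil A z)) :
    pencilInv A z * pencil A z = 1 := Ring.inverse_mul_cancel _ hz

lemma pencil_mul_pencilInv {A : E →L[ℂ] E} {z : ℂ} (hz : IsUnit (pencil A z)) :
    pencil A z * pencilInv A z = 1 := Ring.mul_inverse_cancel _ hz

lemma commute_pencilInv {A B : E →L[ℂ] E} (h : Commute B A) {z : ℂ} (hz : IsUnit (pencil A z)) :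
    Commute B (pencilInv A z) := by
  have h1 : Commute B (pencil A z) := (Commute.one_right B).sub_right (h.smul_right z)
  calc B * pencilInv A z = pencilInv A z * pencil A z * B * pencilInv A z := by
        rw [pencilInv_mul_pencil hz, one_mul]
    _ = pencilInv A z * (B * pencil A z) * pencilInv A z := by rw [h1.eq]; simp only [mul_assoc]
    _ = pencilInv A z * B := by
        simp only [mul_assoc]; rw [pencil_mul_pencilInv hz, mul_one]

lemma pencilInv_sub_pencilInv {A : E →L[ℂ] E} {z w : ℂ} (hz : IsUnit (pencil A z))
    (hw : IsUnit (pencil A w)) :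
    pencilInv A z - pencilInv A w = (z - w) • (A * pencilInv A z * pencilInv A w) := by
  have h : pencil A w - pencil A z = (z - w) • A := by
    simp only [pencil, sub_smul]; abel
  calc pencilInv A z - pencilInv A w
      = pencilInv A z * (pencil A w - pencil A z) * pencilInv A w := by
        rw [mul_sub, sub_mul, mul_assoc, pencil_mul_pencilInv hw, pencilInv_mul_pencil hz,
          mul_one, one_mul]
    _ = _ := by
        rw [h, mul_smul_comm, smul_mul_assoc, (commute_pencilInv (Commute.refl A) hz).eq]

lemma differentiableAt_pencilInv [CompleteSpace E] {A : E →L[ℂ] E} {z : ℂ}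
    (hz : IsUnit (pencil A z)) : DifferentiableAt ℂ (pencilInv A) z := by
  have h1 : DifferentiableAt ℂ (pencil A) z := by
    unfold pencil
    fun_prop
  exact (differentiableAt_inverse (𝕜 := ℂ) hz).comp z h1

lemma circleIntegral_clm_comp {F F' : Type*} [NormedAddCommGroup F] [NormedSpace ℂ F]
    [NormedAddCommGroup F'] [NormedSpace ℂ F'] [CompleteSpace F] [CompleteSpace F']
    (L : F →L[ℂ] F') {f : ℂ → F} {c : ℂ} {R : ℝ} (hf : CircleIntegrable f c R) :
    ∮ z in C(c, R), L (f z) = L (∮ z in C(c, R), f z) := by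
  unfold circleIntegral
  rw [← L.intervalIntegral_comp_comm hf.out]
  simp only [map_smul]

/-- The moment `-(2 π i)⁻¹ ∮ (z - 1) ^ k (I - z A)⁻¹ dz` of the resolvent of the pencil. -/
noncomputable def moment (A : E →L[ℂ] E) (r : ℝ) (k : ℕ) : E →L[ℂ] E :=
  -((2 * (Real.pi : ℂ) * Complex.I)⁻¹ • ∮ z in C((1 : ℂ), r), (z - 1) ^ k • pencilInv A z)

/-- `r` is the radius of a circle about `1` that isolates the point `1` of the spectrum. -/
def Isolating (A : E →L[ℂ] E) (r : ℝ) : Prop :=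
  0 < r ∧ ∀ z ∈ Metric.closedBall (1 : ℂ) r, z ≠ 1 → IsUnit (pencil A z)

lemma spectralProj_eq (A : E →L[ℂ] E) (r : ℝ) : spectralProj A r = moment A r 0 * A := by
  simp [spectralProj, laurentCoeff, moment]

section
variable {A : E →L[ℂ] E} {r : ℝ}

lemma Isolating.mono (h : Isolating A r) {ρ : ℝ} (hρ : 0 < ρ) (hρr : ρ ≤ r) : Isolating A ρ :=
  ⟨hρ, fun z hz => h.2 z (Metric.closedBall_subset_closedBall hρr hz)⟩

lemma ne_one_of_mem_sphere (hr : 0 < r) {z : ℂ} (hz : z ∈ Metric.sphere (1 : ℂ) r) : z ≠ 1 := by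
  rintro rfl
  simp [hr.ne] at hz

lemma Isolating.isUnit_of_mem_sphere (h : Isolating A r) {z : ℂ}
    (hz : z ∈ Metric.sphere (1 : ℂ) r) : IsUnit (pencil A z) :=
  h.2 z (Metric.sphere_subset_closedBall hz) (ne_one_of_mem_sphere h.1 hz)

lemma Isolating.eventually (h : Isolating A r) :
    ∀ᶠ z in 𝓝[≠] (1 : ℂ), z ∈ Metric.ball (1 : ℂ) r ∧ z ≠ 1 ∧ IsUnit (pencil A z) := by
  rw [eventually_nhdsWithin_iff]
  filter_upwards [Metric.ball_mem_nhds (1 : ℂ) h.1] with z hz hz1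
  exact ⟨hz, hz1, h.2 z (Metric.ball_subset_closedBall hz) hz1⟩

/-- With nonnegative order the resolvent would have a limit at 1, and that limit would invert
`pencil A 1`. -/
lemma Isolating.meromorphicOrderAt_neg (h : Isolating A r) (h1 : ¬ IsUnit (pencil A 1))
    (hm : MeromorphicAt (pencilInv A) 1) : meromorphicOrderAt (pencilInv A) 1 < 0 := by
  by_contra! h0
  obtain ⟨S, hS⟩ := tendsto_nhds_of_meromorphicOrderAt_nonneg hm h0
  have hp : Tendsto (pencil A) (𝓝[≠] 1) (𝓝 (pencil A 1)) := by
    have : Continuous (pencil A) := by unfold pencil; fun_prop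
    exact this.continuousAt.tendsto.mono_left nhdsWithin_le_nhds
  refine h1 ⟨⟨pencil A 1, S, tendsto_nhds_unique (hp.mul hS) (tendsto_const_nhds.congr' ?_),
    tendsto_nhds_unique (hS.mul hp) (tendsto_const_nhds.congr' ?_)⟩, rfl⟩
  · filter_upwards [h.eventually] with z hz
    exact (pencil_mul_pencilInv hz.2.2).symm
  · filter_upwards [h.eventually] with z hz
    exact (pencilInv_mul_pencil hz.2.2).symm

variable [CompleteSpace E]

lemma Isolating.circleIntegrable (h : Isolating A r) {g : ℂ → ℂ}
    (hg : ContinuousOn g (Metric.sphere 1 r)) :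
    CircleIntegrable (fun z => g z • pencilInv A z) 1 r :=
  (hg.smul fun _ hz => (differentiableAt_pencilInv
    (h.isUnit_of_mem_sphere hz)).continuousAt.continuousWithinAt).circleIntegrable h.1.le

lemma Isolating.circleIntegrable_pow (h : Isolating A r) (k : ℕ) :
    CircleIntegrable (fun z => (z - 1) ^ k • pencilInv A z) 1 r :=
  h.circleIntegrable (by fun_prop)

lemma Isolating.mul_moment (h : Isolating A r) (B : E →L[ℂ] E) (k : ℕ) :
    B * moment A r k = -((2 * (Real.pi : ℂ) * Complex.I)⁻¹ •
      ∮ z in C((1 : ℂ), r), (z - 1) ^ k • (B * pencilInv A z)) := by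
  have h1 := circleIntegral_clm_comp (ContinuousLinearMap.mul ℂ (E →L[ℂ] E) B)
    (h.circleIntegrable_pow k)
  simp only [ContinuousLinearMap.mul_apply', mul_smul_comm] at h1
  rw [moment, mul_neg, mul_smul_comm, h1]

lemma Isolating.moment_mul (h : Isolating A r) (B : E →L[ℂ] E) (k : ℕ) :
    moment A r k * B = -((2 * (Real.pi : ℂ) * Complex.I)⁻¹ •
      ∮ z in C((1 : ℂ), r), (z - 1) ^ k • (pencilInv A z * B)) := by
  have h1 := circleIntegral_clm_comp ((ContinuousLinearMap.mul ℂ (E →L[ℂ] E)).flip B)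
    (h.circleIntegrable_pow k)
  simp only [ContinuousLinearMap.flip_apply, ContinuousLinearMap.mul_apply', smul_mul_assoc] at h1
  rw [moment, neg_mul, smul_mul_assoc, h1]

lemma Isolating.commute_moment (h : Isolating A r) {B : E →L[ℂ] E} (hB : Commute B A) (k : ℕ) :
    Commute B (moment A r k) := by
  rw [commute_iff_eq, h.mul_moment, h.moment_mul]
  congr 2
  refine circleIntegral.integral_congr h.1.le fun z hz => ?_
  rw [(commute_pencilInv hB (h.isUnit_of_mem_sphere hz)).eq]

/-- Since `(1 - A) - (z - 1) A = I - zA`, the two integrands differ by the entire function `(z - 1)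
^ k`, whose integral vanishes. -/
lemma Isolating.mul_moment_succ (h : Isolating A r) (k : ℕ) :
    A * moment A r (k + 1) = (1 - A) * moment A r k := by
  have hi (B : E →L[ℂ] E) (j : ℕ) :
      CircleIntegrable (fun z => (z - 1) ^ j • (B * pencilInv A z)) 1 r := by
    refine ContinuousOn.circleIntegrable h.1.le fun z hz => ?_
    have := (differentiableAt_pencilInv (h.isUnit_of_mem_sphere hz)).continuousAt
    exact ContinuousAt.continuousWithinAt (by fun_prop)
  rw [← sub_eq_zero, h.mul_moment, h.mul_moment, neg_sub_neg, ← smul_sub,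
    ← circleIntegral.integral_sub (hi _ _) (hi _ _)]
  have h0 : (∮ z in C((1 : ℂ), r), ((z - 1) ^ k • (1 : E →L[ℂ] E))) = 0 :=
    Complex.circleIntegral_eq_zero_of_differentiable_on_off_countable h.1.le
      Set.countable_empty (by fun_prop) fun z _ => by fun_prop
  rw [circleIntegral.integral_congr h.1.le (g := fun z => (z - 1) ^ k • (1 : E →L[ℂ] E)), h0,
    smul_zero]
  intro z hz
  have e : (1 - A) - (z - 1) • A = pencil A z := by
    rw [pencil, sub_smul, one_smul]; abel
  change (z - 1) ^ k • ((1 - A) * pencilInv A z) - (z - 1) ^ (k + 1) • (A * pencilInv A z) = _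
  rw [pow_succ, mul_smul, ← smul_sub, ← smul_mul_assoc, ← sub_mul, e,
    pencil_mul_pencilInv (h.isUnit_of_mem_sphere hz)]

lemma Isolating.moment_eq (h : Isolating A r) {ρ : ℝ} (hρ : 0 < ρ) (hρr : ρ ≤ r) (k : ℕ) :
    moment A ρ k = moment A r k := by
  have hd : ∀ z ∈ Metric.closedBall (1 : ℂ) r, z ≠ 1 →
      DifferentiableAt ℂ (fun z => (z - 1) ^ k • pencilInv A z) z := fun z hz hz1 => by
    have := differentiableAt_pencilInv (h.2 z hz hz1)
    fun_prop
  unfold moment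
  rw [Complex.circleIntegral_eq_of_differentiable_on_annulus_off_countable hρ hρr
    Set.countable_empty]
  · intro z hz
    refine (hd z hz.1 ?_).continuousAt.continuousWithinAt
    rintro rfl
    exact hz.2 (Metric.mem_ball_self hρ)
  · intro z hz
    refine hd z (Metric.ball_subset_closedBall hz.1.1) ?_
    rintro rfl
    exact hz.1.2 (Metric.mem_closedBall_self hρ.le)

lemma Isolating.exists_norm_moment_le (h : Isolating A r) {ρ : ℝ} (hρ : 0 < ρ) (hρr : ρ ≤ r) :
    ∃ C : ℝ, ∀ k, ‖moment A r k‖ ≤ C * ρ ^ k := by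
  have hI := h.mono hρ hρr
  obtain ⟨C, hC⟩ := (isCompact_sphere (1 : ℂ) ρ).exists_bound_of_continuousOn
    (f := pencilInv A) fun z hz =>
      (differentiableAt_pencilInv (hI.isUnit_of_mem_sphere hz)).continuousAt.continuousWithinAt
  refine ⟨ρ * C, fun k => ?_⟩
  rw [← h.moment_eq hρ hρr, moment, norm_neg]
  refine (circleIntegral.norm_two_pi_i_inv_smul_integral_le_of_norm_le_const hρ.le
    (C := ρ ^ k * C) fun z hz => ?_).trans_eq (by ring)
  have hz' : ‖z - 1‖ = ρ := by simpa [dist_eq_norm] using hz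
  rw [norm_smul, norm_pow, hz']
  gcongr
  exact hC z hz

/-! ### Splitting off the analytic part -/

/-- The regular part of the resolvent of the pencil near `1`, as a Cauchy integral. -/
noncomputable def regularPart (A : E →L[ℂ] E) (r : ℝ) (z : ℂ) : E →L[ℂ] E :=
  (2 * (Real.pi : ℂ) * Complex.I)⁻¹ • ∮ w in C((1 : ℂ), r), (w - z)⁻¹ • pencilInv A w

lemma Isolating.analyticOnNhd_regularPart (h : Isolating A r) :
    AnalyticOnNhd ℂ (regularPart A r) (Metric.ball 1 r) := by
  lift r to NNReal using h.1.le
  have h1 := hasFPowerSeriesOn_cauchy_integral (f := pencilInv A) (c := 1) (R := r)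
    (by simpa using h.circleIntegrable_pow 0) (by exact_mod_cast h.1)
  have h2 := h1.analyticOnNhd
  rwa [Metric.eball_coe] at h2

/-- Integrate the resolvent identity over the circle; the term constant in `w` contributes
`pencilInv A z` by Cauchy's formula. -/
lemma Isolating.one_sub_mul_pencilInv (h : Isolating A r) {z : ℂ} (hz : z ∈ Metric.ball (1 : ℂ) r)
    (hz1 : z ≠ 1) :
    (1 - A * moment A r 0) * pencilInv A z = regularPart A r z := by
  have hu := h.2 z (Metric.ball_subset_closedBall hz) hz1
  have hne : ∀ w ∈ Metric.sphere (1 : ℂ) r, w - z ≠ 0 := fun w hw h0 => by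
    rw [sub_eq_zero.1 h0, Metric.mem_sphere] at hw
    exact (Metric.mem_ball.1 hz).ne hw
  have hinv : ContinuousOn (fun w => (w - z)⁻¹) (Metric.sphere (1 : ℂ) r) :=
    ContinuousOn.inv₀ (by fun_prop) hne
  have hconst : CircleIntegrable (fun w => (w - z)⁻¹ • pencilInv A z) 1 r :=
    ContinuousOn.circleIntegrable h.1.le (hinv.smul continuousOn_const)
  have h1 : (A * pencilInv A z) * moment A r 0 = pencilInv A z - regularPart A r z := by
    rw [h.mul_moment, circleIntegral.integral_congr h.1.le
      (g := fun w => (w - z)⁻¹ • pencilInv A w - (w - z)⁻¹ • pencilInv A z),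
      circleIntegral.integral_sub (h.circleIntegrable hinv)
      hconst,
      circleIntegral.integral_smul_const, circleIntegral.integral_sub_inv_of_mem_ball hz,
      smul_sub, smul_smul, inv_mul_cancel₀ Complex.two_pi_I_ne_zero, one_smul, neg_sub,
      regularPart]
    intro w hw
    have h2 := pencilInv_sub_pencilInv hu (h.isUnit_of_mem_sphere hw)
    simp only [pow_zero, one_smul]
    rw [← smul_sub, ← neg_sub (pencilInv A z), h2, ← neg_smul, neg_sub, smul_smul,
      inv_mul_cancel₀ (hne w hw), one_smul]
  have hc : Commute (pencilInv A z) (moment A r 0) :=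
    h.commute_moment (commute_pencilInv (Commute.refl A) hu).symm 0
  rw [sub_mul, one_mul, mul_assoc, ← hc.eq, ← mul_assoc, h1, sub_sub_cancel]

lemma Isolating.mul_moment_mul_moment (h : Isolating A r) (k : ℕ) :
    A * moment A r 0 * moment A r k = moment A r k := by
  -- A second, smaller circle lies inside the disk where the regular part is analytic, so its
  -- moments there vanish.
  have hρ := half_pos h.1
  have hρr := half_lt_self h.1
  have hI := h.mono hρ hρr.le
  have h1 : (1 - A * moment A r 0) * moment A (r / 2) k = 0 := by
    rw [hI.mul_moment, circleIntegral.integral_congr hρ.le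
      (g := fun z => (z - 1) ^ k • regularPart A r z),
      Complex.circleIntegral_eq_zero_of_differentiable_on_off_countable hρ.le
        Set.countable_empty, smul_zero, neg_zero]
    · intro z hz
      have := (h.analyticOnNhd_regularPart z
        (Metric.closedBall_subset_ball hρr hz)).continuousAt
      exact ContinuousAt.continuousWithinAt (by fun_prop)
    · intro z hz
      have := (h.analyticOnNhd_regularPart z
        (Metric.ball_subset_ball hρr.le hz.1)).differentiableAt
      fun_prop
    · intro z hz
      simp only
      rw [h.one_sub_mul_pencilInv (Metric.sphere_subset_ball hρr hz)
        (ne_one_of_mem_sphere hρ hz)]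
  rw [h.moment_eq hρ hρr.le, sub_mul, one_mul, sub_eq_zero] at h1
  exact h1.symm

end
end LinearPencil

/-! ### Powers of `G` and the order of the pole -/

namespace LinearPencil

variable {E : Type*} [NormedAddCommGroup E] [NormedSpace ℂ E] [CompleteSpace E]
  {A : E →L[ℂ] E} {r : ℝ}

lemma Isolating.commute_moment_zero (h : Isolating A r) : Commute A (moment A r 0) :=
  h.commute_moment (Commute.refl A) 0

lemma Isolating.commute_nilPart (h : Isolating A r) : Commute (nilPart A r) A := by
  rw [nilPart, spectralProj_eq]
  exact ((Commute.one_left A).sub_left (Commute.refl A)).mul_left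
    (h.commute_moment_zero.symm.mul_left (Commute.refl A))

lemma Isolating.nilPart_eq (h : Isolating A r) :
    nilPart A r = (1 - A) * (A * moment A r 0) := by
  rw [nilPart, spectralProj_eq, h.commute_moment_zero.eq]

lemma Isolating.nilPart_mul_moment (h : Isolating A r) (k : ℕ) :
    nilPart A r * moment A r k = A * moment A r (k + 1) := by
  rw [h.nilPart_eq, mul_assoc, h.mul_moment_mul_moment, h.mul_moment_succ]

lemma Isolating.nilPart_pow_mul_moment (h : Isolating A r) (j k : ℕ) :
    nilPart A r ^ j * moment A r k = A ^ j * moment A r (k + j) := by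
  induction j with
  | zero => simp
  | succ j ih =>
    rw [pow_succ', mul_assoc, ih, ← mul_assoc, (h.commute_nilPart.pow_right j).eq, mul_assoc,
      h.nilPart_mul_moment, ← mul_assoc, ← pow_succ, add_assoc]

lemma Isolating.nilPart_pow_succ (h : Isolating A r) (k : ℕ) :
    nilPart A r ^ (k + 1) = A ^ (k + 2) * moment A r (k + 1) := by
  have h1 : nilPart A r = A * (A * moment A r 1) := by
    have hc : Commute (1 - A) A := (Commute.one_left A).sub_left (Commute.refl A)
    rw [h.nilPart_eq, ← mul_assoc, hc.eq, mul_assoc, ← h.mul_moment_succ]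
  have hc := h.commute_nilPart.pow_left k
  calc nilPart A r ^ (k + 1) = nilPart A r ^ k * (A * (A * moment A r 1)) := by
        rw [← h1, pow_succ]
    _ = A * (A * (nilPart A r ^ k * moment A r 1)) := by
        rw [← mul_assoc, hc.eq, mul_assoc, ← mul_assoc _ A, hc.eq, mul_assoc]
    _ = A ^ (k + 2) * moment A r (k + 1) := by
        rw [h.nilPart_pow_mul_moment, add_comm 1 k, pow_succ', pow_succ']
        simp only [mul_assoc]

/-- The operator `(I - A) P` is quasinilpotent. -/
lemma Isolating.tendsto_nilPart_pow (h : Isolating A r) {c : ℝ} (hc : 0 < c) :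
    Tendsto (fun n : ℕ => c ^ n * ‖nilPart A r ^ n‖) atTop (𝓝 0) := by
  -- By the moment bound, `c ^ n * ‖G ^ n‖` is at most a constant times `(c * ‖A‖ * ρ) ^ n`; this
  -- radius makes the ratio less than 1.
  set ρ := min r (2 * (c * ‖A‖ + 1))⁻¹ with hρdef
  have hρ : 0 < ρ := lt_min h.1 (by positivity)
  obtain ⟨C, hC⟩ := h.exists_norm_moment_le hρ (min_le_left _ _)
  have hlt : c * ‖A‖ * ρ < 1 := by
    have h1 : ρ ≤ (2 * (c * ‖A‖ + 1))⁻¹ := min_le_right _ _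
    calc c * ‖A‖ * ρ ≤ c * ‖A‖ * (2 * (c * ‖A‖ + 1))⁻¹ := by gcongr
      _ < 1 := by
        rw [← div_eq_mul_inv, div_lt_one (by positivity)]
        nlinarith [mul_nonneg hc.le (norm_nonneg A)]
  have hlim := (tendsto_pow_atTop_nhds_zero_of_lt_one (by positivity) hlt).const_mul (‖A‖ * C)
  rw [mul_zero] at hlim
  refine squeeze_zero' (Eventually.of_forall fun n => by positivity) ?_ hlim
  filter_upwards [eventually_ge_atTop 1] with n hn
  obtain ⟨k, rfl⟩ := Nat.exists_eq_add_of_le' hn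
  rw [h.nilPart_pow_succ]
  calc c ^ (k + 1) * ‖A ^ (k + 2) * moment A r (k + 1)‖
      ≤ c ^ (k + 1) * (‖A‖ ^ (k + 2) * (C * ρ ^ (k + 1))) := by
        gcongr
        exact (norm_mul_le _ _).trans
          (mul_le_mul (norm_pow_le' _ (Nat.succ_pos _)) (hC _) (norm_nonneg _) (by positivity))
    _ = ‖A‖ * C * (c * ‖A‖ * ρ) ^ (k + 1) := by ring

lemma Isolating.moment_eq_zero (h : Isolating A r) {j : ℕ} {q : ℂ → E →L[ℂ] E}
    (hq : AnalyticAt ℂ q 1) (he : ∀ᶠ z in 𝓝[≠] (1 : ℂ), (z - 1) ^ j • pencilInv A z = q z) :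
    moment A r j = 0 := by
  rw [eventually_nhdsWithin_iff] at he
  obtain ⟨ε, hε, hb⟩ := Metric.eventually_nhds_iff_ball.1 (he.and hq.eventually_analyticAt)
  have hρ : 0 < min r (ε / 2) := lt_min h.1 (half_pos hε)
  have hlt : min r (ε / 2) < ε := (min_le_right _ _).trans_lt (half_lt_self hε)
  rw [← h.moment_eq hρ (min_le_left _ _), moment,
    circleIntegral.integral_congr hρ.le (g := q) fun z hz =>
      (hb z (Metric.sphere_subset_ball hlt hz)).1 (ne_one_of_mem_sphere hρ hz),
    Complex.circleIntegral_eq_zero_of_differentiable_on_off_countable hρ.le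
      Set.countable_empty, smul_zero, neg_zero]
  · exact fun z hz =>
      (hb z (Metric.closedBall_subset_ball hlt hz)).2.continuousAt.continuousWithinAt
  · exact fun z hz => (hb z (Metric.ball_subset_ball hlt.le hz.1)).2.differentiableAt

lemma Isolating.nilPart_pow_eq_zero_of_hasPoleOfOrder (h : Isolating A r) {k ℓ : ℕ}
    (hk : k ≤ ℓ + 1) (hp : HasPoleOfOrder (pencilInv A) 1 k) : nilPart A r ^ (ℓ + 1) = 0 := by
  obtain ⟨g, hg, -, he⟩ := (meromorphicOrderAt_eq_int_iff hp.1).1 hp.2.2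
  rw [h.nilPart_pow_succ, h.moment_eq_zero (q := fun z => (z - 1) ^ (ℓ + 1 - k) • g z)
    (by fun_prop), mul_zero]
  filter_upwards [he, self_mem_nhdsWithin] with z hz hz1
  have hz0 : z - 1 ≠ 0 := sub_ne_zero.2 hz1
  rw [hz, smul_smul, zpow_neg, zpow_natCast, pow_sub₀ _ hz0 hk]

/-- Iterates `(z - 1) P R = M G P R - M`, where `R` is the resolvent, `M = M_0` and `P = A M`; once
the power of `M G` vanishes only the analytic `q` remains. -/
lemma Isolating.exists_analyticAt_pow_smul (h : Isolating A r) (j : ℕ) :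
    ∃ q : ℂ → E →L[ℂ] E, AnalyticAt ℂ q 1 ∧ ∀ z, IsUnit (pencil A z) →
      (z - 1) ^ j • (A * moment A r 0 * pencilInv A z) =
        (moment A r 0 * nilPart A r) ^ j * (A * moment A r 0 * pencilInv A z) + q z := by
  set M := moment A r 0
  set P := A * M
  have hMP : M * P = M := by
    change M * (A * M) = M
    rw [← mul_assoc, ← h.commute_moment_zero.eq, h.mul_moment_mul_moment]
  have hMAP : M * A * P = P := by
    rw [← h.commute_moment_zero.eq]
    change A * M * P = P
    rw [mul_assoc, hMP]
  have hG : nilPart A r = (1 - A) * P := h.nilPart_eq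
  have step (z : ℂ) (hz : IsUnit (pencil A z)) :
      (z - 1) • (P * pencilInv A z) = M * nilPart A r * (P * pencilInv A z) - M := by
    have h1 : (z - 1) • A = (1 - A) - pencil A z := by
      rw [pencil, sub_smul, one_smul]; abel
    have hPA : Commute P (pencil A z) := by
      have : Commute P A := (Commute.refl A).mul_left h.commute_moment_zero.symm
      exact (Commute.one_right _).sub_right (this.smul_right z)
    have hPP : P * P = P := by
      change A * M * P = P
      rw [mul_assoc, hMP]
    calc (z - 1) • (P * pencilInv A z) = M * ((z - 1) • A) * (P * pencilInv A z) := by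
          rw [mul_smul_comm, smul_mul_assoc, ← mul_assoc, hMAP]
      _ = M * (1 - A) * (P * pencilInv A z) - M * (P * pencil A z * pencilInv A z) := by
          rw [h1, mul_sub, sub_mul, hPA.eq]; simp only [mul_assoc]
      _ = M * nilPart A r * (P * pencilInv A z) - M := by
          rw [mul_assoc P, pencil_mul_pencilInv hz, mul_one, hMP, hG]
          congr 1
          simp only [mul_assoc]
          rw [← mul_assoc P P, hPP]
  induction j with
  | zero => exact ⟨0, analyticAt_const, fun z _ => by simp⟩
  | succ j ih =>
    obtain ⟨q, hq, he⟩ := ih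
    refine ⟨fun z => (z - 1) • q z - (M * nilPart A r) ^ j * M, by fun_prop, fun z hz => ?_⟩
    rw [pow_succ', mul_smul, he z hz, smul_add, ← mul_smul_comm, step z hz, mul_sub, ← mul_assoc,
      ← pow_succ]
    beta_reduce
    abel

lemma Isolating.exists_analyticAt_of_pow_eq_zero (h : Isolating A r) {ℓ : ℕ}
    (hG : nilPart A r ^ (ℓ + 1) = 0) :
    ∃ q : ℂ → E →L[ℂ] E, AnalyticAt ℂ q 1 ∧
      ∀ᶠ z in 𝓝[≠] (1 : ℂ), pencilInv A z = (z - 1) ^ (-((ℓ + 1 : ℕ) : ℤ)) • q z := by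
  obtain ⟨q, hq, he⟩ := h.exists_analyticAt_pow_smul (ℓ + 1)
  have hc : Commute (moment A r 0) (nilPart A r) :=
    (h.commute_moment h.commute_nilPart 0).symm
  have hH := h.analyticOnNhd_regularPart 1 (Metric.mem_ball_self h.1)
  refine ⟨fun z => (z - 1) ^ (ℓ + 1) • regularPart A r z + q z, by fun_prop, ?_⟩
  filter_upwards [h.eventually] with z ⟨hz, hz1, hu⟩
  have hz0 : (z - 1) ^ (ℓ + 1) ≠ 0 := pow_ne_zero _ (sub_ne_zero.2 hz1)
  have h1 := he z hu
  rw [hc.mul_pow, hG, mul_zero, zero_mul, zero_add] at h1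
  -- Recombines `(1 - P) R` and `P R` into `R`.
  rw [← h1, ← h.one_sub_mul_pencilInv hz hz1, ← smul_add, ← add_mul, sub_add_cancel, one_mul,
    smul_smul, zpow_neg, zpow_natCast, inv_mul_cancel₀ hz0, one_smul]

lemma Isolating.exists_hasPoleOfOrder (h : Isolating A r) (h1 : ¬ IsUnit (pencil A 1)) {ℓ : ℕ}
    (hG : nilPart A r ^ (ℓ + 1) = 0) :
    ∃ k : ℕ, k ≤ ℓ + 1 ∧ HasPoleOfOrder (pencilInv A) 1 k := by
  obtain ⟨q, hq, he⟩ := h.exists_analyticAt_of_pow_eq_zero hG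
  have hz : MeromorphicAt (fun z : ℂ => (z - 1) ^ (-((ℓ + 1 : ℕ) : ℤ))) 1 := by fun_prop
  have hm : MeromorphicAt (pencilInv A) 1 :=
    (hz.smul hq.meromorphicAt).congr (he.mono fun z hz => hz.symm)
  have hneg := h.meromorphicOrderAt_neg h1 hm
  have hge : ((-((ℓ + 1 : ℕ) : ℤ) : ℤ) : WithTop ℤ) ≤ meromorphicOrderAt (pencilInv A) 1 := by
    rw [meromorphicOrderAt_congr he,
      fun_meromorphicOrderAt_smul hz hq.meromorphicAt, fun_meromorphicOrderAt_zpow_id_sub_const]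
    exact le_add_of_nonneg_right hq.meromorphicOrderAt_nonneg
  lift meromorphicOrderAt (pencilInv A) 1 to ℤ using hneg.ne_top with n hn
  norm_cast at hneg hge
  refine ⟨n.natAbs, by omega, hm, by omega, ?_⟩
  rw [← hn]
  congr 1
  omega

end LinearPencil

theorem mainTheorem5 {E : Type*} [NormedAddCommGroup E] [NormedSpace ℂ E] [CompleteSpace E]
    (A : E →L[ℂ] E) (hA : LinearPencil.UnitRoot A)
    (r : ℝ) (hr : 0 < r)
    (hrA : LinearPencil.pencilSpectrum A ∩ Metric.closedBall (1 : ℂ) r = {1})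
    (G : E →L[ℂ] E) (hG : G = LinearPencil.nilPart A r) (ℓ : ℕ) :
    ((∃ k : ℕ, k ≤ ℓ + 1 ∧ LinearPencil.HasPoleOfOrder (LinearPencil.pencilInv A) 1 k) ↔
      (Tendsto (fun n : ℕ => (n : ℝ)⁻¹ * ‖G ^ ℓ * (1 - G) ^ n‖) atTop (𝓝 0) ∧
        ∃ m : ℕ, ℓ + 1 ≤ m ∧ IsClosed (Set.range (G ^ m)))) ∧
    ((Tendsto (fun n : ℕ => (n : ℝ)⁻¹ * ‖G ^ ℓ * (1 - G) ^ n‖) atTop (𝓝 0) ∧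
        ∃ m : ℕ, ℓ + 1 ≤ m ∧ IsClosed (Set.range (G ^ m))) ↔
      G ^ (ℓ + 1) = 0) := by
  have h1 : ¬ IsUnit (LinearPencil.pencil A 1) :=
    (hrA.symm ▸ Set.mem_singleton 1 : (1 : ℂ) ∈ LinearPencil.pencilSpectrum A ∩ _).1
  have h : LinearPencil.Isolating A r := by
    refine ⟨hr, fun z hz hz1 => ?_⟩
    by_contra hu
    exact hz1 (hrA.subset ⟨hu, hz⟩)
  have hac : (∃ k : ℕ, k ≤ ℓ + 1 ∧ LinearPencil.HasPoleOfOrder (LinearPencil.pencilInv A) 1 k) ↔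
      G ^ (ℓ + 1) = 0 := by
    subst hG
    exact ⟨fun ⟨k, hk, hp⟩ => h.nilPart_pow_eq_zero_of_hasPoleOfOrder hk hp,
      h.exists_hasPoleOfOrder h1⟩
  have hbc : (Tendsto (fun n : ℕ => (n : ℝ)⁻¹ * ‖G ^ ℓ * (1 - G) ^ n‖) atTop (𝓝 0) ∧
      ∃ m : ℕ, ℓ + 1 ≤ m ∧ IsClosed (Set.range (G ^ m))) ↔ G ^ (ℓ + 1) = 0 := by
    refine ⟨fun ⟨ht, m, hm, hcl⟩ => LinearPencil.pow_succ_eq_zero_of_tendsto (fun c hc => ?_)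
      ht hm hcl, LinearPencil.tendsto_and_isClosed_of_pow_succ_eq_zero⟩
    subst hG
    exact h.tendsto_nilPart_pow hc
  exact ⟨hac.trans hbc.symm, hbc⟩
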